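/- Let $G$ be a locally compact group with left Haar measure $dx$, let $\mathcal{A}$ be a complex Banach $*$-algebra with isometric involution and a left approximate identity, and let $T:y\mapsto T_y$ be a homomorphism from $G$ into the group of $*$-automorphisms of $\mathcal{A}$ such that $y\mapsto T_ya$ is continuous for every $a\in\mathcal{A}$ and $\sup_{y\in G}\|T_y\|<\infty$ (for instance, each $T_y$ isometric). Let $\mathcal{L}=L^1(G,\mathcal{A},T)$ be the Banach space of Bochner integrable functions $G\to\mathcal{A}$ with the product $$(h\star f)(x)=\int_G T_y\big(h(xy)\big)\,f(y^{-1})\,dy ,$$ and let $\mathcal{L}_d=l^1(G_d,\mathcal{A},T)$ be the corresponding algebra for $G$ with the discrete topology and counting measure, $(h\star f)(x)=\sum_{y\in G} T_y(h(xy))f(y^{-1})$. Let $\rho:\mathcal{L}\to \mathrm{End}(E)$ be a non-trivial algebraically irreducible representation on a complex vector space $E\neq 0$ (that is, $\rho$ is linear and multiplicative, $\rho\ne0$, and $0$ and $E$ are the only $\rho(\mathcal{L})$-invariant linear subspaces). For $\xi_0\in E\setminus\{0\}$ put $\|\xi\|_E=\inf\{\|f\|_{\mathcal L}: f\in\mathcal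 L,\ \rho(f)\xi_0=\xi\}$; this is a complete norm on $E$, and different $\xi_0$ give equivalent norms. There are unique representations of the group $G$ and of the algebra $\mathcal{A}$ on $E$, also denoted by $\rho$, with $$\rho(x)\rho(f)=\rho(\lambda_xf),\qquad \rho(a)\rho(f)=\rho(a\cdot f)\qquad(x\in G,\ a\in\mathcal{A},\ f\in\mathcal{L}),$$ where $(\lambda_xf)(t)=f(x^{-1}t)$ and $(a\cdot f)(t)=T_{t^{-1}}(a)f(t)$. They satisfy $\rho(y^{-1})\rho(a)\rho(y)=\rho(T_{y^{-1}}a)$ and $\rho(f)\xi=\int_G\rho(x)\rho(f(x))\xi\,dx$. The formula $$\rho_d(h)\xi=\sum_{x\in G}\rho(x)\rho(h(x))\xi\qquad(h\in\mathcal{L}_d,\ \xi\in E),$$ with convergence with respect to $\|\cdot\|_E$, defines a representation $\rho_d$ of $\mathcal{L}_d$ on $E$, the discretised version of $\rho$. Then $\rho_d$ is algebraically irreducible. -/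

import Mathlib

open MeasureTheory Filter Topology
open scoped ENNReal Pointwise

noncomputable section

namespace TwistedL1

/-! ### Twisted actions -/

/-- A strongly continuous homomorphism `T` from a topological group `G` into the group of
star-automorphisms of the Banach star-algebra `A`, with `‖T y a‖ ≤ C * ‖a‖` for some constant `C`
(for instance an action by isometries, where `C = 1`). -/
structure BoundedAction (G A : Type*) [Group G] [TopologicalSpace G]
    [NonUnitalNormedRing A] [StarRing A] [NormedSpace ℂ A] where
  /-- the underlying homomorphism into the automorphism group -/
  aut : G →* (A ≃⋆ₐ[ℂ] A)
  continuous_aut : ∀ a : A, Continuous fun y : G => aut y a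
  bounded_aut : ∃ C : ℝ, ∀ (y : G) (a : A), ‖aut y a‖ ≤ C * ‖a‖

section Action

variable {G A : Type*} [Group G] [TopologicalSpace G]
  [NonUnitalNormedRing A] [StarRing A] [NormedSpace ℂ A]

theorem BoundedAction.exists_bound (T : BoundedAction G A) :
    ∃ C : ℝ, 0 ≤ C ∧ ∀ (y : G) (a : A), ‖T.aut y a‖ ≤ C * ‖a‖ := by
  obtain ⟨C, hC⟩ := T.bounded_aut
  refine ⟨max C 0, le_max_right _ _, fun y a => (hC y a).trans ?_⟩
  exact mul_le_mul_of_nonneg_right (le_max_left _ _) (norm_nonneg _)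

/-- The action is jointly continuous. -/
theorem BoundedAction.continuous_uncurry (T : BoundedAction G A) :
    Continuous fun p : G × A => T.aut p.1 p.2 := by
  obtain ⟨C, hC0, hC⟩ := T.exists_bound
  rw [continuous_iff_continuousAt]
  rintro ⟨y₀, a₀⟩
  have h1 : Tendsto (fun p : G × A => T.aut p.1 a₀) (𝓝 (y₀, a₀)) (𝓝 (T.aut y₀ a₀)) :=
    ((T.continuous_aut a₀).comp continuous_fst).continuousAt
  have h2 : Tendsto (fun p : G × A => T.aut p.1 (p.2 - a₀)) (𝓝 (y₀, a₀)) (𝓝 0) := by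
    refine squeeze_zero_norm (fun p => hC p.1 (p.2 - a₀)) ?_
    have : Continuous fun p : G × A => C * ‖p.2 - a₀‖ := by fun_prop
    simpa using this.tendsto (y₀, a₀)
  have h3 := h1.add h2
  rw [add_zero] at h3
  refine h3.congr fun p => ?_
  rw [← map_add]
  congr 1
  abel

end Action

/-! ### The twisted convolution on `L¹(G, A)` -/

section Continuous

variable {G A : Type*} [Group G] [TopologicalSpace G] [IsTopologicalGroup G]
  [MeasurableSpace G] [BorelSpace G]
  [NonUnitalNormedRing A] [StarRing A] [NormedSpace ℂ A]

theorem aestronglyMeasurable_restrict (μ : Measure G) [μ.Regular] {X : Type*}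
    [NormedAddCommGroup X] {φ : G → X} (hφ : Continuous φ) {B : Set G} (hB : MeasurableSet B)
    (hμB : μ B ≠ ∞) : AEStronglyMeasurable φ (μ.restrict B) := by
  have key : ∀ n : ℕ, ∃ K, K ⊆ B ∧ IsCompact K ∧ IsClosed K ∧
      μ (B \ K) < ENNReal.ofReal (1 / ((n : ℝ) + 1)) := fun n =>
    hB.exists_isCompact_isClosed_sdiff_lt hμB (ENNReal.ofReal_pos.2 (by positivity)).ne'
  choose K hKB hKc hKcl hKμ using key
  have h1 : AEStronglyMeasurable φ (μ.restrict (⋃ n, K n)) := aestronglyMeasurable_iUnion_iff.2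
    fun n => hφ.continuousOn.aestronglyMeasurable_of_isCompact (hKc n) (hKcl n).measurableSet
  have h2 : μ (B \ ⋃ n, K n) = 0 := by
    have ht : Tendsto (fun n : ℕ => ENNReal.ofReal (1 / ((n : ℝ) + 1))) atTop (𝓝 0) := by
      simpa using ENNReal.tendsto_ofReal (tendsto_one_div_add_atTop_nhds_zero_nat (𝕜 := ℝ))
    refine le_antisymm (ge_of_tendsto' ht fun n => ?_) zero_le
    exact (measure_mono (Set.sdiff_subset_sdiff_right (Set.subset_iUnion K n))).trans (hKμ n).le
  have h3 : B =ᵐ[μ] ⋃ n, K n :=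
    (ae_le_set.2 h2).antisymm (Set.iUnion_subset hKB).eventuallyLE
  rwa [Measure.restrict_congr_set h3]

/-- If `f` is integrable and `Φ` is continuous with `Φ (x, 0) = 0`, then `x ↦ Φ (x, f x)` is
strongly measurable almost everywhere. -/
theorem aestronglyMeasurable_comp_L1 (μ : Measure G) [μ.Regular] {Y X : Type*}
    [NormedAddCommGroup Y] [NormedAddCommGroup X] {Φ : G × Y → X} (hΦ : Continuous Φ) (hΦ0 : ∀ x, Φ (x, 0) = 0)
    (f : G →₁[μ] Y) : AEStronglyMeasurable (fun x => Φ (x, f x)) μ := by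
  obtain ⟨g, hg, hgt⟩ := Lp.finStronglyMeasurable f one_ne_zero ENNReal.one_ne_top
  refine aestronglyMeasurable_of_tendsto_ae atTop (f := fun n x => Φ (x, g n x)) (fun n => ?_)
    (.of_forall fun x => (hΦ.tendsto _).comp (tendsto_const_nhds.prodMk_nhds (hgt x)))
  have hun : ⋃ c : (g n).range, g n ⁻¹' {c.1} = Set.univ := by
    ext x
    simp
  rw [← Measure.restrict_univ (μ := μ), ← hun, aestronglyMeasurable_iUnion_iff]
  rintro ⟨c, -⟩
  have hB : MeasurableSet (g n ⁻¹' {c}) := (g n).measurableSet_fiber c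
  have heq : (fun x => Φ (x, g n x)) =ᵐ[μ.restrict (g n ⁻¹' {c})] fun x => Φ (x, c) := by
    filter_upwards [ae_restrict_mem hB] with x hx
    rw [Set.mem_preimage, Set.mem_singleton_iff] at hx
    rw [hx]
  refine AEStronglyMeasurable.congr ?_ heq.symm
  by_cases hc : c = 0
  · simp only [hc, hΦ0]
    exact aestronglyMeasurable_const
  · refine aestronglyMeasurable_restrict μ (by fun_prop) hB (ne_top_of_le_ne_top (hg n).ne ?_)
    refine measure_mono fun x hx => ?_
    rw [Set.mem_preimage, Set.mem_singleton_iff] at hx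
    rw [Function.mem_support, hx]
    exact hc

variable (T : BoundedAction G A) (μ : Measure G) [μ.Regular]

/-- For `a : A` and `f` integrable, the function `x ↦ T_{x⁻¹}(a) f(x)` is integrable. -/
theorem integrable_coeffMul (a : A) (f : G →₁[μ] A) :
    Integrable (fun x => T.aut x⁻¹ a * f x) μ := by
  obtain ⟨C, hC0, hC⟩ := T.exists_bound
  have hmeas : AEStronglyMeasurable (fun x => T.aut x⁻¹ a * f x) μ :=
    aestronglyMeasurable_comp_L1 μ (Φ := fun p => T.aut p.1⁻¹ a * p.2)
      (((T.continuous_aut a).comp (continuous_inv.comp continuous_fst)).mul continuous_snd)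
      (fun x => mul_zero _) f
  refine ((L1.integrable_coeFn f).norm.const_mul (C * ‖a‖)).mono' hmeas (.of_forall fun x => ?_)
  exact (norm_mul_le _ _).trans (mul_le_mul_of_nonneg_right (hC _ _) (norm_nonneg _))

variable [μ.IsHaarMeasure]

/-- The left action of the coefficient algebra on `L¹(G, A)`: `(a · f)(x) = T_{x⁻¹}(a) f(x)`. -/
def coeffMul (a : A) (f : G →₁[μ] A) : G →₁[μ] A :=
  (integrable_coeffMul T μ a f).toL1 _

/-- Left translation on `L¹(G, A)`: `(λ_z f)(x) = f(z⁻¹ x)`. -/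
def translate (z : G) (f : G →₁[μ] A) : G →₁[μ] A :=
  Lp.compMeasurePreserving (fun x => z⁻¹ * x) (measurePreserving_mul_left μ z⁻¹) f

theorem translate_coeffMul_ae_eq (z : G) (a : A) (f : G →₁[μ] A) :
    translate μ z (coeffMul T μ a f) =ᵐ[μ] fun x => T.aut (x⁻¹ * z) a * f (z⁻¹ * x) := by
  have h1 := Lp.coeFn_compMeasurePreserving (coeffMul T μ a f) (measurePreserving_mul_left μ z⁻¹)
  have h2 := (measurePreserving_mul_left μ z⁻¹).quasiMeasurePreserving.ae
    (integrable_coeffMul T μ a f).coeFn_toL1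
  filter_upwards [h1, h2] with x hx1 hx2
  refine hx1.trans (hx2.trans ?_)
  simp

/-- The twisted convolution on `L¹(G, A, T)`,
`(h ⋆ f)(x) = ∫ T_y (h (x y)) f (y⁻¹) dy = ∫ T_{x⁻¹ z} (h z) f (z⁻¹ x) dz`.
The second integral is read as the Bochner integral, with values in `L¹(G, A)`, of
`z ↦ λ_z (h z · f)`; see `translate_coeffMul_ae_eq` for the integrand, `integrable_conv` for its
integrability and `conv_ae_eq` for the pointwise formula. -/
def conv (h f : G →₁[μ] A) : G →₁[μ] A :=
  ∫ z, translate μ z (coeffMul T μ (h z) f) ∂μ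

theorem norm_coeffMul_le {C : ℝ} (hC : ∀ (y : G) (a : A), ‖T.aut y a‖ ≤ C * ‖a‖)
    (a : A) (f : G →₁[μ] A) : ‖coeffMul T μ a f‖ ≤ C * ‖a‖ * ‖f‖ := by
  rw [L1.norm_eq_integral_norm f, ← integral_const_mul, L1.norm_eq_integral_norm]
  refine integral_mono_ae (L1.integrable_coeFn _).norm
    ((L1.integrable_coeFn f).norm.const_mul _) ?_
  filter_upwards [(integrable_coeffMul T μ a f).coeFn_toL1] with x hx
  change ‖(integrable_coeffMul T μ a f).toL1 _ x‖ ≤ _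
  rw [hx]
  exact (norm_mul_le _ _).trans (mul_le_mul_of_nonneg_right (hC _ _) (norm_nonneg _))

theorem coeffMul_sub (a b : A) (f : G →₁[μ] A) :
    coeffMul T μ (a - b) f = coeffMul T μ a f - coeffMul T μ b f := by
  unfold coeffMul
  rw [← Integrable.toL1_sub]
  congr 1
  ext x
  simp [sub_mul]

theorem continuous_coeffMul (f : G →₁[μ] A) : Continuous fun a => coeffMul T μ a f := by
  obtain ⟨C, hC0, hC⟩ := T.exists_bound
  rw [continuous_iff_continuousAt]
  intro b
  rw [ContinuousAt, tendsto_iff_norm_sub_tendsto_zero]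
  have : Continuous fun a : A => C * ‖a - b‖ * ‖f‖ := by fun_prop
  refine squeeze_zero (fun _ => norm_nonneg _) (fun a => ?_) (by simpa using this.tendsto b)
  rw [← coeffMul_sub]
  exact norm_coeffMul_le T μ hC _ _

theorem continuous_translate_coeffMul [LocallyCompactSpace G] (f : G →₁[μ] A) :
    Continuous fun p : G × A => translate μ p.1 (coeffMul T μ p.2 f) := by
  have hg : Continuous fun p : G × A => (ContinuousMap.mk (fun x : G => p.1⁻¹ * x)
      (continuous_const_mul _) : C(G, G)) :=
    ((ContinuousMap.mk (fun p : G × G => p.1⁻¹ * p.2)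
      (by fun_prop)).curry).continuous.comp continuous_fst
  exact ((continuous_coeffMul T μ f).comp continuous_snd).compMeasurePreservingLp hg
    (fun p => measurePreserving_mul_left μ p.1⁻¹) ENNReal.one_ne_top

/-- The integral that defines the twisted convolution exists. -/
theorem integrable_conv [LocallyCompactSpace G] (h f : G →₁[μ] A) :
    Integrable (fun z => translate μ z (coeffMul T μ (h z) f)) μ := by
  obtain ⟨C, hC0, hC⟩ := T.exists_bound
  have h0 : coeffMul T μ (0 : A) f = 0 := by
    simpa using coeffMul_sub T μ (0 : A) 0 f
  have hmeas : AEStronglyMeasurable (fun z => translate μ z (coeffMul T μ (h z) f)) μ :=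
    aestronglyMeasurable_comp_L1 μ (continuous_translate_coeffMul T μ f)
      (fun z => by simp [h0, translate]) h
  refine (((L1.integrable_coeFn h).norm.const_mul C).mul_const ‖f‖).mono' hmeas
    (.of_forall fun z => ?_)
  exact (Lp.norm_compMeasurePreserving _ _).trans_le (norm_coeffMul_le T μ hC _ _)

/-- The pointwise formula for the twisted convolution of continuous functions with compact
support. -/
theorem conv_ae_eq [LocallyCompactSpace G] [CompleteSpace A] (h f : G →₁[μ] A) (h' f' : G → A)
    (hh : h =ᵐ[μ] h') (hf : f =ᵐ[μ] f') (hc : Continuous h') (fc : Continuous f')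
    (hs : HasCompactSupport h') (fs : HasCompactSupport f') :
    conv T μ h f =ᵐ[μ] fun x => ∫ y, T.aut y (h' (x * y)) * f' y⁻¹ ∂μ := by
  let F : G → G → A := fun z x => T.aut (x⁻¹ * z) (h' z) * f' (z⁻¹ * x)
  have hFc : Continuous F.uncurry := by
    refine Continuous.mul (T.continuous_uncurry.comp (Continuous.prodMk ?_ ?_)) (fc.comp ?_)
    · fun_prop
    · exact hc.comp continuous_fst
    · fun_prop
  have hF0 : ∀ z x, ¬ (z ∈ tsupport h' ∧ x ∈ tsupport h' * tsupport f') → F z x = 0 := by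
    intro z x hzx
    by_cases hz : z ∈ tsupport h'
    · have : z⁻¹ * x ∉ tsupport f' := fun hx => hzx ⟨hz, ⟨z, hz, z⁻¹ * x, hx, by simp⟩⟩
      simp [F, image_eq_zero_of_notMem_tsupport this]
    · simp [F, image_eq_zero_of_notMem_tsupport hz]
  have hFs : HasCompactSupport F.uncurry :=
    HasCompactSupport.intro (hs.isCompact.prod (hs.isCompact.mul fs.isCompact))
      fun p hp => hF0 p.1 p.2 hp
  have hk : ∀ x, ∫ y, T.aut y (h' (x * y)) * f' y⁻¹ ∂μ = ∫ z, F z x ∂μ := by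
    intro x
    rw [← integral_mul_left_eq_self (fun z => F z x) x]
    simp only [F, inv_mul_cancel_left, mul_inv_rev, inv_mul_cancel_right]
  have hkc : Continuous fun x => ∫ z, F z x ∂μ := by
    rw [← continuousOn_univ]
    refine continuousOn_integral_of_compact_support (f := fun x z => F z x) hs.isCompact
      (hFc.comp continuous_swap).continuousOn fun x z _ hz => hF0 z x fun h => hz h.1
  have hks : HasCompactSupport fun x => ∫ z, F z x ∂μ :=
    HasCompactSupport.intro (hs.isCompact.mul fs.isCompact) fun x hx => by
      simp [fun z => hF0 z x fun h => hx h.2]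
  simp_rw [hk]
  refine Integrable.ae_eq_of_forall_setIntegral_eq _ _ (L1.integrable_coeFn _)
    (hkc.integrable_of_hasCompactSupport hks) fun s _ _ => ?_
  let Λ : (G →₁[μ] A) →L[ℝ] A :=
    { toFun := fun g => ∫ x in s, g x ∂μ
      map_add' := fun g₁ g₂ => by
        rw [← integral_add (L1.integrable_coeFn g₁).integrableOn
          (L1.integrable_coeFn g₂).integrableOn]
        exact integral_congr_ae (ae_restrict_of_ae (Lp.coeFn_add g₁ g₂))
      map_smul' := fun c g => by
        rw [RingHom.id_apply, ← integral_smul]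
        exact integral_congr_ae (ae_restrict_of_ae (Lp.coeFn_smul c g))
      cont := continuous_setIntegral s }
  have hΛ : ∀ g : G →₁[μ] A, Λ g = ∫ x in s, g x ∂μ := fun _ => rfl
  rw [← hΛ, conv, ← Λ.integral_comp_comm (integrable_conv T μ h f),
    ← integral_integral_swap_of_hasCompactSupport hFc hFs]
  refine integral_congr_ae ?_
  filter_upwards [hh] with z hz
  rw [hΛ]
  refine integral_congr_ae (ae_restrict_of_ae ?_)
  filter_upwards [translate_coeffMul_ae_eq T μ z (h z) f,
    (measurePreserving_mul_left μ z⁻¹).quasiMeasurePreserving.ae hf] with x hx hx'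
  rw [hx, hx', hz]

end Continuous

/-! ### The twisted convolution on `ℓ¹(G_d, A, T)` -/

section Discrete

variable {G A : Type*} [Group G] [TopologicalSpace G]
  [NonUnitalNormedRing A] [StarRing A] [NormedSpace ℂ A] (T : BoundedAction G A)

theorem memℓp_discreteConv (h f : lp (fun _ : G => A) 1) :
    Memℓp (fun x : G => ∑' y : G, T.aut y (h (x * y)) * f y⁻¹) 1 := by
  obtain ⟨C, hC0, hC⟩ := T.exists_bound
  have hsum : ∀ k : lp (fun _ : G => A) 1, Summable fun x => ‖k x‖ := fun k => by
    simpa using (lp.memℓp k).summable (by simp)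
  have h1 : Summable fun p : G × G => C * (‖h p.1‖ * ‖f p.2‖) :=
    ((hsum h).mul_of_nonneg (hsum f) (fun _ => norm_nonneg _) (fun _ => norm_nonneg _)).mul_left C
  let e : G × G ≃ G × G :=
    { toFun := fun p => (p.1 * p.2, p.2⁻¹)
      invFun := fun p => (p.1 * p.2, p.2⁻¹)
      left_inv := fun p => by simp
      right_inv := fun p => by simp }
  have h2 : Summable fun p : G × G => ‖T.aut p.2 (h (p.1 * p.2)) * f p.2⁻¹‖ := by
    refine Summable.of_nonneg_of_le (fun _ => norm_nonneg _) (fun p => ?_) (e.summable_iff.2 h1)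
    refine (norm_mul_le _ _).trans ?_
    simp only [Function.comp, e, Equiv.coe_fn_mk, ← mul_assoc]
    exact mul_le_mul_of_nonneg_right (hC _ _) (norm_nonneg _)
  refine memℓp_gen ?_
  simp only [ENNReal.toReal_one, Real.rpow_one]
  exact Summable.of_nonneg_of_le (fun _ => norm_nonneg _)
    (fun x => norm_tsum_le_tsum_norm (h2.prod_factor x)) h2.prod

/-- The twisted convolution on `ℓ¹(G_d, A, T)`: `(h ⋆ f)(x) = ∑_y T_y (h (x y)) f (y⁻¹)`. -/
def discreteConv (h f : lp (fun _ : G => A) 1) : lp (fun _ : G => A) 1 :=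
  ⟨fun x : G => ∑' y : G, T.aut y (h (x * y)) * f y⁻¹, memℓp_discreteConv T h f⟩

end Discrete

/-! ### Representations on a complex vector space -/

/-- A family `π : B → End E` of operators on a vector space, linear in `B`, is algebraically
irreducible if `E ≠ 0`, `π ≠ 0` and there are no invariant linear subspaces but `0` and `E`. -/
def IsAlgIrreducible {B E : Type*} [AddCommGroup B] [Module ℂ B] [AddCommGroup E] [Module ℂ E]
    (π : B →ₗ[ℂ] Module.End ℂ E) : Prop :=
  Nontrivial E ∧ π ≠ 0 ∧
    ∀ F : Submodule ℂ E, (∀ b : B, ∀ ξ ∈ F, π b ξ ∈ F) → F = ⊥ ∨ F = ⊤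

section Representations

variable {G A : Type*} [Group G] [TopologicalSpace G] [IsTopologicalGroup G]
  [MeasurableSpace G] [BorelSpace G]
  [NonUnitalNormedRing A] [StarRing A] [NormedSpace ℂ A]
  [IsScalarTower ℂ A A] [SMulCommClass ℂ A A]

/-- A representation of the algebra `L¹(G, A, T)` by linear operators on `E`. -/
structure Rep (T : BoundedAction G A) (μ : Measure G) [μ.IsHaarMeasure] [μ.Regular]
    (E : Type*) [AddCommGroup E] [Module ℂ E] where
  /-- the underlying linear map -/
  op : (G →₁[μ] A) →ₗ[ℂ] Module.End ℂ E
  op_conv : ∀ h f : G →₁[μ] A, op (conv T μ h f) = op h * op f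

/-- A representation of the algebra `ℓ¹(G_d, A, T)` by linear operators on `E`. -/
@[ext]
structure DiscreteRep (T : BoundedAction G A) (E : Type*) [AddCommGroup E] [Module ℂ E] where
  /-- the underlying linear map -/
  op : lp (fun _ : G => A) 1 →ₗ[ℂ] Module.End ℂ E
  op_conv : ∀ h f : lp (fun _ : G => A) 1, op (discreteConv T h f) = op h * op f

variable {T : BoundedAction G A} {μ : Measure G} [μ.IsHaarMeasure] [μ.Regular]
  {E : Type*} [AddCommGroup E] [Module ℂ E]

/-- The norm `‖ξ‖_E = inf {‖f‖ : ρ(f) ξ₀ = ξ}` on `E`, for a given `ξ₀ ≠ 0`. -/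
def Rep.orbitNorm (ρ : Rep T μ E) (ξ₀ ξ : E) : ℝ :=
  sInf {r : ℝ | ∃ f : G →₁[μ] A, ρ.op f ξ₀ = ξ ∧ r = ‖f‖}

/-- `η` is the (unconditional) sum of the family `v` with respect to `‖·‖_E`, for each choice of
`ξ₀ ≠ 0`. -/
def Rep.HasSumInNorm (ρ : Rep T μ E) {ι : Type*} (v : ι → E) (η : E) : Prop :=
  ∀ ξ₀ : E, ξ₀ ≠ 0 →
    Tendsto (fun s : Finset ι => ρ.orbitNorm ξ₀ (∑ i ∈ s, v i - η)) atTop (𝓝 0)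

/-- A linear functional on `E` is bounded with respect to `‖·‖_E`, for each choice of `ξ₀ ≠ 0`. -/
def Rep.IsBoundedFunctional (ρ : Rep T μ E) (φ : E →ₗ[ℂ] ℂ) : Prop :=
  ∀ ξ₀ : E, ξ₀ ≠ 0 → ∃ c : ℝ, ∀ η : E, ‖φ η‖ ≤ c * ρ.orbitNorm ξ₀ η

/-- The representations `U` of the group `G` and `R` of the Banach algebra `A` on `E` that belong
to the representation `ρ` of `L¹(G, A, T)`. They are given by `U(x) ρ(f) = ρ(λ_x f)` and
`R(a) ρ(f) = ρ(a · f)`, they satisfy `U(y⁻¹) R(a) U(y) = R(T_{y⁻¹} a)`, and `ρ` is their integrated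
form, `ρ(f) ξ = ∫ U(x) R(f(x)) ξ dx`; the integral is taken weakly, against the linear functionals
that are bounded with respect to `‖·‖_E`. -/
structure Rep.IsCovariantPair (ρ : Rep T μ E) (U : G →* Module.End ℂ E)
    (R : A →ₙₐ[ℂ] Module.End ℂ E) : Prop where
  group_mul : ∀ (x : G) (f : G →₁[μ] A), U x * ρ.op f = ρ.op (translate μ x f)
  algebra_mul : ∀ (a : A) (f : G →₁[μ] A), R a * ρ.op f = ρ.op (coeffMul T μ a f)
  covariance : ∀ (y : G) (a : A), U y⁻¹ * R a * U y = R (T.aut y⁻¹ a)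
  integrated : ∀ φ : E →ₗ[ℂ] ℂ, ρ.IsBoundedFunctional φ → ∀ (f : G →₁[μ] A) (ξ : E),
    Integrable (fun x => φ (U x (R (f x) ξ))) μ ∧
      φ (ρ.op f ξ) = ∫ x, φ (U x (R (f x) ξ)) ∂μ

/-- `ρd` is the discretised version of `ρ`: `ρd(h) ξ = ∑_x ρ(x) ρ(h(x)) ξ`, where `x ↦ ρ(x)` and
`a ↦ ρ(a)` are the representations of `G` and of `A` that belong to `ρ` and the sum converges with
respect to `‖·‖_E`. -/
def Rep.IsDiscretisation (ρ : Rep T μ E) (ρd : DiscreteRep T E) : Prop :=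
  ∃ (U : G →* Module.End ℂ E) (R : A →ₙₐ[ℂ] Module.End ℂ E), ρ.IsCovariantPair U R ∧
    ∀ (h : lp (fun _ : G => A) 1) (ξ : E),
      ρ.HasSumInNorm (fun x : G => U x (R (h x) ξ)) (ρd.op h ξ)

end Representations

end TwistedL1

end

/-!
Write `L` for `L¹(G, A, T)` and `ρ(L) ξ` for the orbit of a vector `ξ`. The group and the
coefficient algebra act on `L` by left translation and by coefficient multiplication, and each
`h ∈ ℓ¹(G_d, A, T)` acts by the norm convergent sum `D_h f = ∑_x λ_x (h x · f)` (`discreteOp`). The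
twisted convolution is itself the Bochner integral `f ⋆ w = ∫ λ_z (f z · w) dz`, so that `D_h w` is
the convolution of `w` with a discrete measure.

*Existence and uniqueness of the discretised representation.* Irreducibility makes every orbit
`ρ(L) ξ` with `ξ ≠ 0` all of `E`, and it makes a vector killed by `ρ(L)` vanish. As left convolution
by `g` after a translation or a coefficient multiplication is left convolution by some `g'`
(`exists_conv_translate`, `exists_conv_coeffMul`), these operations descend to `E`
(`Rep.descends_of_conv`). The annihilator of a vector is closed in `L`, as for a maximal modular
left ideal of a Banach algebra (`Rep.isClosed_ker_orbit`). Hence limits with respect to `‖·‖_E` are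
unique, the operators `D_h` descend as well, and any discretisation satisfies
`ρd(h) ρ(f) ξ = ρ(D_h f) ξ` (`Rep.IsDiscretisation.op_op`), which determines it.

*Irreducibility.* Let `ξ ≠ 0` and `ρ(w) ξ = ξ`. By the Hahn-Banach theorem, `f ⋆ w` is a limit of
vectors `D_h w` with `‖h‖ ≤ r`, for any `r > ‖f‖` (`conv_mem_closure_discreteOp`). Thus
`ρ(f) ξ = ρ(f ⋆ w) ξ` is approximated by `ρ(D_h w) ξ = ρd(h) ξ`, with control of `‖h‖` by `‖f‖`.
Applying this to the successive errors gives a series that converges in `ℓ¹(G_d, A, T)` to some `h`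
with `ρd(h) ξ = ρ(f) ξ` (`Rep.IsDiscretisation.exists_op_eq`). Therefore `ρd` acts transitively on
the non-zero vectors of `E`.
-/

noncomputable section

namespace TwistedL1

section Operators

variable {G A : Type*} [Group G] [TopologicalSpace G] [IsTopologicalGroup G]
  [MeasurableSpace G] [BorelSpace G]
  [NonUnitalNormedRing A] [StarRing A] [NormedSpace ℂ A]
  [IsScalarTower ℂ A A] [SMulCommClass ℂ A A]
  (T : BoundedAction G A) (μ : Measure G) [μ.IsHaarMeasure] [μ.Regular]

/-! ### Translations and coefficients as bounded operators on `L¹(G, A)` -/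

omit [IsScalarTower ℂ A A] [SMulCommClass ℂ A A] [μ.IsHaarMeasure] in
theorem coeffMul_ae_eq (a : A) (f : G →₁[μ] A) :
    coeffMul T μ a f =ᵐ[μ] fun x => T.aut x⁻¹ a * f x :=
  (integrable_coeffMul T μ a f).coeFn_toL1

omit [StarRing A] [NormedSpace ℂ A] [IsScalarTower ℂ A A] [SMulCommClass ℂ A A] [μ.Regular] in
theorem translate_ae_eq (z : G) (f : G →₁[μ] A) :
    translate μ z f =ᵐ[μ] fun x => f (z⁻¹ * x) :=
  Lp.coeFn_compMeasurePreserving f (measurePreserving_mul_left μ z⁻¹)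

/-- Left translation as a linear isometry. -/
def translateL (z : G) : (G →₁[μ] A) →ₗᵢ[ℂ] (G →₁[μ] A) :=
  Lp.compMeasurePreservingₗᵢ ℂ (fun x => z⁻¹ * x) (measurePreserving_mul_left μ z⁻¹)

omit [StarRing A] [IsScalarTower ℂ A A] [SMulCommClass ℂ A A] [μ.Regular] in
@[simp] theorem translateL_apply (z : G) (f : G →₁[μ] A) :
    translateL μ z f = translate μ z f := rfl

omit [StarRing A] [NormedSpace ℂ A] [IsScalarTower ℂ A A] [SMulCommClass ℂ A A] [μ.Regular] in
theorem translate_one (f : G →₁[μ] A) : translate μ 1 f = f := by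
  refine Lp.ext ?_
  filter_upwards [translate_ae_eq μ 1 f] with x hx
  simpa using hx

omit [StarRing A] [NormedSpace ℂ A] [IsScalarTower ℂ A A] [SMulCommClass ℂ A A] [μ.Regular] in
theorem translate_translate (y z : G) (f : G →₁[μ] A) :
    translate μ y (translate μ z f) = translate μ (y * z) f := by
  refine Lp.ext ?_
  filter_upwards [translate_ae_eq μ y (translate μ z f), translate_ae_eq μ (y * z) f,
    (measurePreserving_mul_left μ y⁻¹).quasiMeasurePreserving.ae (translate_ae_eq μ z f)]
    with x h1 h2 h3
  rw [h1, h2, h3, mul_inv_rev, mul_assoc]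

/-- The action of the coefficient algebra as a bounded bilinear map. -/
def coeffMulL : A →L[ℂ] (G →₁[μ] A) →L[ℂ] (G →₁[μ] A) :=
  LinearMap.mkContinuous₂
    (LinearMap.mk₂ ℂ (coeffMul T μ)
      (fun a b f => Lp.ext <| by
        filter_upwards [coeffMul_ae_eq T μ (a + b) f, coeffMul_ae_eq T μ a f,
          coeffMul_ae_eq T μ b f, Lp.coeFn_add (coeffMul T μ a f) (coeffMul T μ b f)]
          with x h1 h2 h3 h4
        rw [h1, h4, Pi.add_apply, h2, h3, map_add, add_mul])
      (fun c a f => Lp.ext <| by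
        filter_upwards [coeffMul_ae_eq T μ (c • a) f, coeffMul_ae_eq T μ a f,
          Lp.coeFn_smul c (coeffMul T μ a f)] with x h1 h2 h3
        rw [h1, h3, Pi.smul_apply, h2, map_smul, smul_mul_assoc])
      (fun a f g => Lp.ext <| by
        filter_upwards [coeffMul_ae_eq T μ a (f + g), coeffMul_ae_eq T μ a f,
          coeffMul_ae_eq T μ a g, Lp.coeFn_add (coeffMul T μ a f) (coeffMul T μ a g),
          Lp.coeFn_add f g] with x h1 h2 h3 h4 h5
        rw [h1, h4, h5, Pi.add_apply, Pi.add_apply, h2, h3, mul_add])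
      (fun c a f => Lp.ext <| by
        filter_upwards [coeffMul_ae_eq T μ a (c • f), coeffMul_ae_eq T μ a f,
          Lp.coeFn_smul c (coeffMul T μ a f), Lp.coeFn_smul c f] with x h1 h2 h3 h4
        rw [h1, h3, h4, Pi.smul_apply, Pi.smul_apply, h2, mul_smul_comm]))
    T.exists_bound.choose (norm_coeffMul_le T μ T.exists_bound.choose_spec.2)

@[simp] theorem coeffMulL_apply (a : A) (f : G →₁[μ] A) :
    coeffMulL T μ a f = coeffMul T μ a f := rfl

omit [IsScalarTower ℂ A A] [SMulCommClass ℂ A A] [μ.IsHaarMeasure] in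
theorem coeffMul_coeffMul (a b : A) (f : G →₁[μ] A) :
    coeffMul T μ a (coeffMul T μ b f) = coeffMul T μ (a * b) f := by
  refine Lp.ext ?_
  filter_upwards [coeffMul_ae_eq T μ a (coeffMul T μ b f), coeffMul_ae_eq T μ b f,
    coeffMul_ae_eq T μ (a * b) f] with x h1 h2 h3
  rw [h1, h2, h3, map_mul, mul_assoc]

omit [IsScalarTower ℂ A A] [SMulCommClass ℂ A A] in
theorem coeffMul_translate (a : A) (z : G) (f : G →₁[μ] A) :
    coeffMul T μ a (translate μ z f) = translate μ z (coeffMul T μ (T.aut z⁻¹ a) f) := by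
  refine Lp.ext ?_
  filter_upwards [coeffMul_ae_eq T μ a (translate μ z f), translate_ae_eq μ z f,
    translate_coeffMul_ae_eq T μ z (T.aut z⁻¹ a) f] with x h1 h2 h3
  have h4 : T.aut (x⁻¹ * z) (T.aut z⁻¹ a) = T.aut x⁻¹ a := by
    change (T.aut (x⁻¹ * z) * T.aut z⁻¹) a = _
    rw [← map_mul, mul_inv_cancel_right]
  rw [h1, h2, h3, h4]

/-- The operator `f ↦ λ_z (a · f)` on `L¹(G, A)`: left convolution by the point mass at `z` with
value `a`. -/
def pointOp (z : G) : A →L[ℂ] (G →₁[μ] A) →L[ℂ] (G →₁[μ] A) :=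
  (ContinuousLinearMap.compL ℂ _ _ _ (translateL μ z).toContinuousLinearMap).comp (coeffMulL T μ)

@[simp] theorem pointOp_apply (z : G) (a : A) (f : G →₁[μ] A) :
    pointOp T μ z a f = translate μ z (coeffMul T μ a f) := rfl

theorem exists_norm_pointOp_le :
    ∃ C : ℝ, 0 ≤ C ∧ ∀ (z : G) (a : A), ‖pointOp T μ z a‖ ≤ C * ‖a‖ := by
  obtain ⟨C, hC0, hC⟩ := T.exists_bound
  refine ⟨C, hC0, fun z a => ContinuousLinearMap.opNorm_le_bound _ (by positivity) fun f => ?_⟩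
  exact (Lp.norm_compMeasurePreserving _ _).trans_le (norm_coeffMul_le T μ hC _ _)

theorem pointOp_comp_pointOp (x y : G) (a b : A) :
    (pointOp T μ x a).comp (pointOp T μ y b) = pointOp T μ (x * y) (T.aut y⁻¹ a * b) := by
  ext1 f
  simp only [ContinuousLinearMap.comp_apply, pointOp_apply]
  rw [coeffMul_translate, translate_translate, coeffMul_coeffMul]

/-! ### The convolution as a bounded bilinear map -/

section Conv

variable [LocallyCompactSpace G]

/-- The twisted convolution as a bounded bilinear map. -/
def convL : (G →₁[μ] A) →L[ℂ] (G →₁[μ] A) →L[ℂ] (G →₁[μ] A) :=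
  LinearMap.mkContinuous₂
    (LinearMap.mk₂ ℂ (conv T μ)
      (fun h k f => by
        unfold conv
        rw [← integral_add (integrable_conv T μ h f) (integrable_conv T μ k f)]
        refine integral_congr_ae ?_
        filter_upwards [Lp.coeFn_add h k] with z hz
        simp only [← pointOp_apply, hz, Pi.add_apply, map_add, add_apply])
      (fun c h f => by
        unfold conv
        rw [← integral_smul]
        refine integral_congr_ae ?_
        filter_upwards [Lp.coeFn_smul c h] with z hz
        simp only [← pointOp_apply, hz, Pi.smul_apply, map_smul, smul_apply])
      (fun h f g => by
        unfold conv
        rw [← integral_add (integrable_conv T μ h f) (integrable_conv T μ h g)]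
        simp only [← pointOp_apply, map_add])
      (fun c h f => by
        unfold conv
        rw [← integral_smul]
        simp only [← pointOp_apply, map_smul]))
    (exists_norm_pointOp_le T μ).choose fun h f => by
      have hC := (exists_norm_pointOp_le T μ).choose_spec.2
      generalize (exists_norm_pointOp_le T μ).choose = C at hC
      rw [L1.norm_eq_integral_norm h, ← integral_const_mul, ← integral_mul_const]
      refine norm_integral_le_of_norm_le
        (((L1.integrable_coeFn h).norm.const_mul C).mul_const ‖f‖) (.of_forall fun z => ?_)
      exact (pointOp T μ z (h z)).le_of_opNorm_le (hC _ _) f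

@[simp] theorem convL_apply (h f : G →₁[μ] A) : convL T μ h f = conv T μ h f := rfl

omit [IsScalarTower ℂ A A] [SMulCommClass ℂ A A] in
theorem integral_comp_conv {X : Type*} [NormedAddCommGroup X] [NormedSpace ℂ X] [CompleteSpace X]
    [CompleteSpace A] (φ : (G →₁[μ] A) →L[ℂ] X) (h f : G →₁[μ] A) :
    φ (conv T μ h f) = ∫ z, φ (translate μ z (coeffMul T μ (h z) f)) ∂μ :=
  (φ.integral_comp_comm (integrable_conv T μ h f)).symm

omit [LocallyCompactSpace G] in
/-- `g ⋆ (a · f) = (g a) ⋆ f`, where `g a` is a pointwise product. -/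
theorem exists_conv_coeffMul (g : G →₁[μ] A) (a : A) :
    ∃ g' : G →₁[μ] A, ∀ f, conv T μ g (coeffMul T μ a f) = conv T μ g' f := by
  have hi : Integrable (fun x => g x * a) μ :=
    ((ContinuousLinearMap.mul ℂ A).flip a).integrable_comp (L1.integrable_coeFn g)
  refine ⟨hi.toL1 _, fun f => integral_congr_ae ?_⟩
  filter_upwards [hi.coeFn_toL1] with z hz
  rw [hz, coeffMul_coeffMul]

/-- `g ⋆ λ_x f = g' ⋆ f`, where `g'(z) = c T_{x⁻¹} (g (z x⁻¹))`. The constant `c` comes from the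
modular function: the image of `μ` under right translation is a multiple of `μ`. -/
theorem exists_conv_translate (g : G →₁[μ] A) (x : G) :
    ∃ g' : G →₁[μ] A, ∀ f, conv T μ g (translate μ x f) = conv T μ g' f := by
  obtain ⟨C, hC0, hC⟩ := T.exists_bound
  let τ : A →L[ℂ] A := LinearMap.mkContinuous
    { toFun := T.aut x⁻¹, map_add' := map_add _, map_smul' := map_smul _ } C (hC x⁻¹)
  let e : G ≃ᵐ G := MeasurableEquiv.mulRight x
  have : (μ.map e).Regular := Measure.Regular.map (Homeomorph.mulRight x)
  have : (μ.map e).IsHaarMeasure := Measure.isHaarMeasure_map_mul_right μ x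
  set c := Measure.haarScalarFactor (μ.map e) μ with hc
  have hc0 : c ≠ 0 := (Measure.haarScalarFactor_pos_of_isHaarMeasure _ _).ne'
  have hν : μ.map e = c • μ := Measure.isMulLeftInvariant_eq_smul_of_regular _ _
  let u : G → A := fun z => τ (g (z * x⁻¹))
  have hue : ∀ z, u (e z) = τ (g z) := fun z => by
    change τ (g (z * x * x⁻¹)) = _
    rw [mul_inv_cancel_right]
  have hu : Integrable u μ := by
    have h1 : Integrable u (μ.map e) := by
      rw [integrable_map_equiv]
      exact (τ.integrable_comp (L1.integrable_coeFn g)).congr (.of_forall fun z => (hue z).symm)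
    rw [hν] at h1
    exact (integrable_smul_measure (c := (c : ℝ≥0∞)) (by simpa using hc0) ENNReal.coe_ne_top).1 h1
  refine ⟨(c : ℂ) • hu.toL1 u, fun f => ?_⟩
  have h2 : conv T μ g (translate μ x f) =
      ∫ z, translate μ z (coeffMul T μ (u z) f) ∂(μ.map e) := by
    rw [integral_map_equiv]
    refine integral_congr_ae (.of_forall fun z => ?_)
    simp only [hue]
    rw [coeffMul_translate, translate_translate]
    rfl
  rw [h2, hν, integral_smul_nnreal_measure, ← convL_apply, map_smul, smul_apply, convL_apply]
  rw [NNReal.smul_def, Complex.coe_smul]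
  congr 1
  refine integral_congr_ae ?_
  filter_upwards [hu.coeFn_toL1] with z hz
  rw [hz]

end Conv

end Operators

/-! ### The action of `ℓ¹(G_d, A, T)` on `L¹(G, A)` -/

section DiscreteOp

variable {G A : Type*} [Group G]

section Norm

variable [NormedAddCommGroup A]

omit [Group G] in
theorem summable_norm_lp_one (h : lp (fun _ : G => A) 1) : Summable fun x => ‖h x‖ := by
  simpa using (lp.memℓp h).summable (by simp)

omit [Group G] in
theorem norm_lp_one_eq_tsum (h : lp (fun _ : G => A) 1) : ‖h‖ = ∑' x, ‖h x‖ := by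
  simpa using lp.norm_eq_tsum_rpow (by simp) h

end Norm

variable [TopologicalSpace G] [IsTopologicalGroup G] [MeasurableSpace G] [BorelSpace G]
  [NonUnitalNormedRing A] [CompleteSpace A] [StarRing A] [NormedSpace ℂ A]
  [IsScalarTower ℂ A A] [SMulCommClass ℂ A A]
  (T : BoundedAction G A) (μ : Measure G) [μ.IsHaarMeasure] [μ.Regular]

omit [CompleteSpace A] in
theorem summable_norm_pointOp (h : lp (fun _ : G => A) 1) :
    Summable fun x => ‖pointOp T μ x (h x)‖ := by
  obtain ⟨C, hC0, hC⟩ := exists_norm_pointOp_le T μ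
  exact ((summable_norm_lp_one h).mul_left C).of_nonneg_of_le (fun _ => norm_nonneg _)
    fun x => hC x (h x)

/-- The operator `f ↦ ∑_x λ_x (h x · f)` on `L¹(G, A)`: left convolution by the discrete measure
with density `h`. -/
def discreteOp : lp (fun _ : G => A) 1 →L[ℂ] (G →₁[μ] A) →L[ℂ] (G →₁[μ] A) :=
  LinearMap.mkContinuous
    { toFun := fun h => ∑' x, pointOp T μ x (h x)
      map_add' := fun h k => by
        rw [← (summable_norm_pointOp T μ h).of_norm.tsum_add (summable_norm_pointOp T μ k).of_norm]
        simp only [lp.coeFn_add, Pi.add_apply, map_add]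
      map_smul' := fun c h => by
        rw [RingHom.id_apply, ← (summable_norm_pointOp T μ h).of_norm.tsum_const_smul c]
        simp only [lp.coeFn_smul, Pi.smul_apply, map_smul] }
    (exists_norm_pointOp_le T μ).choose fun h => by
      have hC := (exists_norm_pointOp_le T μ).choose_spec.2
      generalize (exists_norm_pointOp_le T μ).choose = C at hC
      rw [norm_lp_one_eq_tsum, ← tsum_mul_left]
      exact tsum_of_norm_bounded ((summable_norm_lp_one h).mul_left C).hasSum fun x => hC x (h x)

theorem hasSum_discreteOp (h : lp (fun _ : G => A) 1) :
    HasSum (fun x => pointOp T μ x (h x)) (discreteOp T μ h) :=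
  (summable_norm_pointOp T μ h).of_norm.hasSum

theorem hasSum_discreteOp_apply (h : lp (fun _ : G => A) 1) (f : G →₁[μ] A) :
    HasSum (fun x => translate μ x (coeffMul T μ (h x) f)) (discreteOp T μ h f) :=
  (hasSum_discreteOp T μ h).mapL (ContinuousLinearMap.apply ℂ (G →₁[μ] A) f)

theorem discreteOp_single [DecidableEq G] (x : G) (a : A) :
    discreteOp T μ (lp.single 1 x a) = pointOp T μ x a := by
  refine (hasSum_discreteOp T μ _).unique ?_
  have h := hasSum_single
    (f := fun y => pointOp T μ y ((lp.single 1 x a : lp (fun _ : G => A) 1) y)) x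
    fun y hy => by rw [lp.single_apply_ne _ _ _ hy, map_zero]
  rwa [lp.single_apply_self] at h

theorem discreteOp_discreteConv (h k : lp (fun _ : G => A) 1) :
    discreteOp T μ (discreteConv T h k) = discreteOp T μ h * discreteOp T μ k := by
  -- The substitution `(z, y) ↦ (z y, y⁻¹)` turns the sum over pairs of point masses into the sum
  -- over `z` of the sums over `y` that define the convolution.
  let e : G × G ≃ G × G :=
    { toFun := fun p => (p.1 * p.2, p.2⁻¹)
      invFun := fun p => (p.1 * p.2, p.2⁻¹)
      left_inv := fun p => by simp
      right_inv := fun p => by simp }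
  have hs := (e.summable_iff.2 <| summable_mul_of_summable_norm
    (summable_norm_pointOp T μ h) (summable_norm_pointOp T μ k))
  have hp : ∀ z y, pointOp T μ (z * y) (h (z * y)) * pointOp T μ y⁻¹ (k y⁻¹) =
      pointOp T μ z (T.aut y (h (z * y)) * k y⁻¹) := fun z y => by
    refine (pointOp_comp_pointOp T μ _ _ _ _).trans ?_
    rw [mul_inv_cancel_right, inv_inv]
  refine (hasSum_discreteOp T μ _).tsum_eq.symm.trans (Eq.symm ?_)
  rw [← (hasSum_discreteOp T μ h).tsum_eq, ← (hasSum_discreteOp T μ k).tsum_eq,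
    tsum_mul_tsum_of_summable_norm (summable_norm_pointOp T μ h) (summable_norm_pointOp T μ k)]
  refine ((e.tsum_eq _).symm.trans hs.tsum_prod).trans (tsum_congr fun z => ?_)
  obtain ⟨C, hC0, hC⟩ := T.exists_bound
  have hz : Summable fun y => T.aut y (h (z * y)) * k y⁻¹ := by
    have hk : Summable fun y => C * ‖h‖ * ‖k y⁻¹‖ :=
      ((Equiv.inv G).summable_iff.2 (summable_norm_lp_one k)).mul_left _
    refine Summable.of_norm_bounded hk fun y => (norm_mul_le _ _).trans ?_
    gcongr
    refine (hC _ _).trans ?_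
    gcongr
    exact lp.norm_apply_le_norm one_ne_zero h _
  exact (tsum_congr (hp z)).trans ((pointOp T μ z).map_tsum hz).symm

end DiscreteOp

namespace Rep

variable {G A E : Type*} [Group G] [TopologicalSpace G] [IsTopologicalGroup G]
  [LocallyCompactSpace G] [MeasurableSpace G] [BorelSpace G]
  [NonUnitalNormedRing A] [StarRing A] [NormedSpace ℂ A]
  [IsScalarTower ℂ A A] [SMulCommClass ℂ A A]
  {T : BoundedAction G A} {μ : Measure G} [μ.IsHaarMeasure] [μ.Regular]
  [AddCommGroup E] [Module ℂ E] (ρ : Rep T μ E)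

/-! ### Irreducible representations of `L¹(G, A, T)` -/

/-- The orbit map `f ↦ ρ(f) ξ`. -/
def orbit (ξ : E) : (G →₁[μ] A) →ₗ[ℂ] E := ρ.op.flip ξ

omit [LocallyCompactSpace G] [IsScalarTower ℂ A A] [SMulCommClass ℂ A A] in
@[simp] theorem orbit_apply (ξ : E) (f : G →₁[μ] A) : ρ.orbit ξ f = ρ.op f ξ := rfl

omit [LocallyCompactSpace G] [IsScalarTower ℂ A A] [SMulCommClass ℂ A A] in
theorem op_conv_apply (g f : G →₁[μ] A) (ξ : E) : ρ.op (conv T μ g f) ξ = ρ.op g (ρ.op f ξ) := by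
  rw [ρ.op_conv]
  rfl

variable {ρ} (hρ : IsAlgIrreducible ρ.op)
include hρ

omit [LocallyCompactSpace G] [IsScalarTower ℂ A A] [SMulCommClass ℂ A A] in
theorem eq_zero_of_forall_op_eq_zero {v : E} (hv : ∀ g, ρ.op g v = 0) : v = 0 := by
  let F : Submodule ℂ E := ⨅ g, LinearMap.ker (ρ.op g)
  have hF : ∀ {w}, w ∈ F ↔ ∀ g, ρ.op g w = 0 := by simp [F, Submodule.mem_iInf]
  rcases hρ.2.2 F fun g w hw => by rw [hF.1 hw g]; exact F.zero_mem with h | h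
  · have : v ∈ F := hF.2 hv
    rwa [h, Submodule.mem_bot] at this
  · exact absurd (LinearMap.ext fun g => LinearMap.ext fun w =>
      hF.1 (h ▸ Submodule.mem_top : w ∈ F) g) hρ.2.1

omit [LocallyCompactSpace G] [IsScalarTower ℂ A A] [SMulCommClass ℂ A A] in
theorem eq_of_forall_op_eq {v w : E} (h : ∀ g, ρ.op g v = ρ.op g w) : v = w :=
  sub_eq_zero.1 <| eq_zero_of_forall_op_eq_zero hρ fun g => by rw [map_sub, h, sub_self]

omit [LocallyCompactSpace G] [IsScalarTower ℂ A A] [SMulCommClass ℂ A A] in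
theorem orbit_surjective {ξ : E} (hξ : ξ ≠ 0) : Function.Surjective (ρ.orbit ξ) := by
  rw [← LinearMap.range_eq_top]
  refine (hρ.2.2 (LinearMap.range (ρ.orbit ξ)) ?_).resolve_left fun h => hξ ?_
  · rintro g _ ⟨f, rfl⟩
    exact ⟨conv T μ g f, ρ.op_conv_apply g f ξ⟩
  · exact eq_zero_of_forall_op_eq_zero hρ fun g => (Submodule.mem_bot ℂ).1 (h ▸ ⟨g, rfl⟩)

/-- Annihilators of vectors are closed. The closure of the annihilator of `ξ` is a left ideal, so
that otherwise it contains some `v` with `ρ(v) ξ = ξ`, and the annihilator contains some `m` close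
to `v`. Then `w = v - m` is small with `ρ(w) ξ = ξ`, and a solution of `p - p ⋆ w = w`, given by the
Neumann series, leads to `ξ = ρ(p) ξ - ρ(p) ρ(w) ξ = 0`. -/
theorem isClosed_ker_orbit [CompleteSpace A] (ξ : E) :
    IsClosed (LinearMap.ker (ρ.orbit ξ) : Set (G →₁[μ] A)) := by
  set M := LinearMap.ker (ρ.orbit ξ) with hM
  have hmem : ∀ {f}, f ∈ M ↔ ρ.op f ξ = 0 := Iff.rfl
  have hideal : ∀ g, ∀ f ∈ M.topologicalClosure, conv T μ g f ∈ M.topologicalClosure :=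
    fun g f hf => map_mem_closure (convL T μ g).continuous hf fun m hm => by
      change ρ.op (conv T μ g m) ξ = 0
      rw [op_conv_apply, hmem.1 hm, map_zero]
  rcases hρ.2.2 (M.topologicalClosure.map (ρ.orbit ξ)) (by
    rintro g _ ⟨f, hf, rfl⟩
    exact ⟨conv T μ g f, hideal g f hf, ρ.op_conv_apply g f ξ⟩) with h | h
  · refine isClosed_of_closure_subset fun f hf => ?_
    have : ρ.orbit ξ f ∈ M.topologicalClosure.map (ρ.orbit ξ) := Submodule.mem_map_of_mem hf
    rwa [h] at this
  · obtain ⟨v, hv, hvξ⟩ : ξ ∈ M.topologicalClosure.map (ρ.orbit ξ) := h ▸ Submodule.mem_top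
    let r : (G →₁[μ] A) →L[ℂ] (G →₁[μ] A) →L[ℂ] (G →₁[μ] A) := (convL T μ).flip
    obtain ⟨m, hm, hmM⟩ := mem_closure_iff.1 hv {m | ‖r (v - m)‖ < 1}
      (isOpen_lt (by fun_prop) continuous_const) (by simp)
    set w := v - m with hw
    have hwξ : ρ.op w ξ = ξ := by
      rw [hw, map_sub, LinearMap.sub_apply, hmem.1 hmM, sub_zero]
      exact hvξ
    let u := Units.oneSub (r w) hm
    obtain ⟨p, hp⟩ : ∃ p, p - conv T μ p w = w := ⟨u.inv w, DFunLike.congr_fun u.val_inv w⟩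
    have h0 : ξ = 0 := by
      have := congrArg (fun f => ρ.op f ξ) hp
      simpa only [map_sub, LinearMap.sub_apply, op_conv_apply, hwξ, sub_self] using this.symm
    have : M = ⊤ := by
      rw [eq_top_iff]
      intro f _
      rw [hmem, h0, map_zero]
    rw [this]
    exact isClosed_univ

/-! ### The norms of `E` -/

omit hρ [LocallyCompactSpace G] [IsScalarTower ℂ A A] [SMulCommClass ℂ A A] in
theorem orbitNorm_nonneg (ξ v : E) : 0 ≤ ρ.orbitNorm ξ v :=
  Real.sInf_nonneg <| by rintro _ ⟨f, -, rfl⟩; exact norm_nonneg f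

omit hρ [LocallyCompactSpace G] [IsScalarTower ℂ A A] [SMulCommClass ℂ A A] in
theorem orbitNorm_op_le (ξ : E) (f : G →₁[μ] A) : ρ.orbitNorm ξ (ρ.op f ξ) ≤ ‖f‖ :=
  csInf_le ⟨0, by rintro _ ⟨f, -, rfl⟩; exact norm_nonneg f⟩ ⟨f, rfl, rfl⟩

omit [LocallyCompactSpace G] [IsScalarTower ℂ A A] [SMulCommClass ℂ A A] in
theorem exists_op_eq_norm_lt {ξ : E} (hξ : ξ ≠ 0) {v : E} {ε : ℝ} (h : ρ.orbitNorm ξ v < ε) :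
    ∃ f : G →₁[μ] A, ρ.op f ξ = v ∧ ‖f‖ < ε := by
  obtain ⟨g, hg⟩ := orbit_surjective hρ hξ v
  obtain ⟨_, ⟨f, hf, rfl⟩, hlt⟩ := exists_lt_of_csInf_lt (by exact ⟨_, g, hg, rfl⟩) h
  exact ⟨f, hf, hlt⟩

theorem hasSumInNorm_op {ι : Type*} {F : ι → G →₁[μ] A} {H : G →₁[μ] A} (hF : HasSum F H) (ξ : E) :
    ρ.HasSumInNorm (fun i => ρ.op (F i) ξ) (ρ.op H ξ) := by
  intro ξ₁ hξ₁
  obtain ⟨w, hw⟩ := orbit_surjective hρ hξ₁ ξ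
  rw [orbit_apply] at hw
  have hFw : HasSum (fun i => conv T μ (F i) w) (conv T μ H w) :=
    hF.mapL ((convL T μ).flip w)
  refine squeeze_zero (fun s => orbitNorm_nonneg _ _) (fun s => ?_)
    (tendsto_iff_norm_sub_tendsto_zero.1 hFw)
  convert orbitNorm_op_le (ρ := ρ) ξ₁ (∑ i ∈ s, conv T μ (F i) w - conv T μ H w) using 2
  simp only [map_sub, map_sum, LinearMap.sub_apply, LinearMap.sum_apply, op_conv_apply, hw]

theorem HasSumInNorm.unique [CompleteSpace A] {ι : Type*} {v : ι → E} {η η' : E}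
    (h : ρ.HasSumInNorm v η) (h' : ρ.HasSumInNorm v η') : η = η' := by
  obtain ⟨ξ, hξ⟩ := @exists_ne E hρ.1 0
  obtain ⟨k, hk⟩ := orbit_surjective hρ hξ (η - η')
  have hkM : k ∈ LinearMap.ker (ρ.orbit ξ) := by
    refine (isClosed_ker_orbit hρ ξ).closure_subset (Metric.mem_closure_iff.2 fun ε hε => ?_)
    obtain ⟨s, hs, hs'⟩ := (((h ξ hξ).eventually_lt_const (half_pos hε)).and
      ((h' ξ hξ).eventually_lt_const (half_pos hε))).exists
    obtain ⟨f, hf, hfε⟩ := exists_op_eq_norm_lt hρ hξ hs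
    obtain ⟨g, hg, hgε⟩ := exists_op_eq_norm_lt hρ hξ hs'
    refine ⟨k - (g - f), ?_, ?_⟩
    · rw [SetLike.mem_coe, LinearMap.mem_ker, map_sub, map_sub, hk, orbit_apply, orbit_apply,
        hf, hg]
      abel
    · rw [dist_eq_norm, sub_sub_cancel]
      linarith [norm_sub_le g f]
  rw [LinearMap.mem_ker, hk] at hkM
  exact sub_eq_zero.1 hkM

theorem IsCovariantPair.hasSumInNorm_op_op [CompleteSpace A] {U : G →* Module.End ℂ E}
    {R : A →ₙₐ[ℂ] Module.End ℂ E} (hUR : ρ.IsCovariantPair U R) (h : lp (fun _ : G => A) 1)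
    (f : G →₁[μ] A) (ξ : E) :
    ρ.HasSumInNorm (fun x => U x (R (h x) (ρ.op f ξ))) (ρ.op (discreteOp T μ h f) ξ) := by
  convert hasSumInNorm_op hρ (hasSum_discreteOp_apply T μ h f) ξ using 2 with x
  rw [← hUR.group_mul, ← hUR.algebra_mul]
  rfl

theorem IsDiscretisation.op_op [CompleteSpace A] {ρd : DiscreteRep T E}
    (hd : ρ.IsDiscretisation ρd) (h : lp (fun _ : G => A) 1) (f : G →₁[μ] A) (ξ : E) :
    ρd.op h (ρ.op f ξ) = ρ.op (discreteOp T μ h f) ξ := by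
  obtain ⟨U, R, hUR, hsum⟩ := hd
  exact HasSumInNorm.unique hρ (hsum h (ρ.op f ξ)) (hUR.hasSumInNorm_op_op hρ h f ξ)

theorem IsDiscretisation.unique [CompleteSpace A] {ρd ρd' : DiscreteRep T E}
    (hd : ρ.IsDiscretisation ρd) (hd' : ρ.IsDiscretisation ρd') : ρd = ρd' := by
  obtain ⟨ξ, hξ⟩ := @exists_ne E hρ.1 0
  refine DiscreteRep.ext (LinearMap.ext fun h => LinearMap.ext fun v => ?_)
  obtain ⟨f, rfl⟩ := orbit_surjective hρ hξ v
  rw [orbit_apply, hd.op_op hρ, hd'.op_op hρ]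

end Rep

namespace Rep

variable {G A E : Type*} [Group G] [TopologicalSpace G] [IsTopologicalGroup G]
  [LocallyCompactSpace G] [MeasurableSpace G] [BorelSpace G]
  [NonUnitalNormedRing A] [CompleteSpace A] [StarRing A] [NormedSpace ℂ A]
  [IsScalarTower ℂ A A] [SMulCommClass ℂ A A]
  {T : BoundedAction G A} {μ : Measure G} [μ.IsHaarMeasure] [μ.Regular]
  [AddCommGroup E] [Module ℂ E] {ρ : Rep T μ E}

/-! ### Existence of the discretised representation -/

/-- An operator `D` on `L¹(G, A)` descends to `E`: the formula `ρ(f) ξ ↦ ρ(D f) ξ` is consistent. -/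
def Descends (ρ : Rep T μ E) (D : (G →₁[μ] A) →L[ℂ] (G →₁[μ] A)) : Prop :=
  ∀ (f f' : G →₁[μ] A) (ξ ξ' : E), ρ.op f ξ = ρ.op f' ξ' → ρ.op (D f) ξ = ρ.op (D f') ξ'

/-- The operator on `E` induced by an operator `D` on `L¹(G, A)`, where `s` is a linear section of
the orbit map of `ξ₀`. -/
def induced (ρ : Rep T μ E) (ξ₀ : E) (s : E →ₗ[ℂ] (G →₁[μ] A)) :
    ((G →₁[μ] A) →L[ℂ] (G →₁[μ] A)) →ₗ[ℂ] Module.End ℂ E where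
  toFun D := ρ.orbit ξ₀ ∘ₗ D.toLinearMap ∘ₗ s
  map_add' D D' := by ext v; simp
  map_smul' c D := by ext v; simp

omit [LocallyCompactSpace G] [CompleteSpace A] [IsScalarTower ℂ A A] [SMulCommClass ℂ A A] in
theorem Descends.induced_op {D : (G →₁[μ] A) →L[ℂ] (G →₁[μ] A)} (hD : ρ.Descends D) {ξ₀ : E}
    {s : E →ₗ[ℂ] (G →₁[μ] A)} (hs : ∀ v, ρ.op (s v) ξ₀ = v) (f : G →₁[μ] A) (ξ : E) :
    ρ.induced ξ₀ s D (ρ.op f ξ) = ρ.op (D f) ξ :=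
  hD _ _ _ _ (hs _)

variable (hρ : IsAlgIrreducible ρ.op)
include hρ

omit [LocallyCompactSpace G] [CompleteSpace A] [IsScalarTower ℂ A A] [SMulCommClass ℂ A A] in
/-- If left convolution by `g` after `D` is always left convolution by some `g'`, then `D`
descends, because a vector of `E` is determined by its images under `ρ(L¹(G, A))`. -/
theorem descends_of_conv {D : (G →₁[μ] A) →L[ℂ] (G →₁[μ] A)}
    (hD : ∀ g, ∃ g', ∀ f, conv T μ g (D f) = conv T μ g' f) : ρ.Descends D := by
  refine fun f f' ξ ξ' h => eq_of_forall_op_eq hρ fun g => ?_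
  obtain ⟨g', hg'⟩ := hD g
  rw [← op_conv_apply, ← op_conv_apply, hg', hg', op_conv_apply, op_conv_apply, h]

omit [CompleteSpace A] in
theorem descends_translate (x : G) : ρ.Descends (translateL μ x).toContinuousLinearMap :=
  descends_of_conv hρ fun g => exists_conv_translate T μ g x

omit [LocallyCompactSpace G] [CompleteSpace A] in
theorem descends_coeffMul (a : A) : ρ.Descends (coeffMulL T μ a) :=
  descends_of_conv hρ fun g => exists_conv_coeffMul T μ g a

theorem descends_discreteOp (h : lp (fun _ : G => A) 1) : ρ.Descends (discreteOp T μ h) := by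
  intro f f' ξ ξ' hf
  refine HasSumInNorm.unique hρ (hasSumInNorm_op hρ (hasSum_discreteOp_apply T μ h f) ξ) ?_
  convert hasSumInNorm_op hρ (hasSum_discreteOp_apply T μ h f') ξ' using 2 with x
  exact descends_translate hρ x _ _ _ _ (descends_coeffMul hρ (h x) _ _ _ _ hf)

theorem exists_isCovariantPair : ∃ (U : G →* Module.End ℂ E) (R : A →ₙₐ[ℂ] Module.End ℂ E),
    ρ.IsCovariantPair U R := by
  obtain ⟨ξ₀, hξ₀⟩ := @exists_ne E hρ.1 0
  obtain ⟨s, hs'⟩ := (ρ.orbit ξ₀).exists_rightInverse_of_surjective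
    (LinearMap.range_eq_top.2 (orbit_surjective hρ hξ₀))
  have hs : ∀ v, ρ.op (s v) ξ₀ = v := LinearMap.congr_fun hs'
  have hU := fun (x : G) => (descends_translate hρ x).induced_op hs
  have hR := fun (a : A) => (descends_coeffMul hρ a).induced_op hs
  have hext : ∀ {S S' : Module.End ℂ E}, (∀ f, S (ρ.op f ξ₀) = S' (ρ.op f ξ₀)) → S = S' :=
    fun h => LinearMap.ext fun v => by rw [← hs v, h]
  simp only [LinearIsometry.coe_toContinuousLinearMap, translateL_apply, coeffMulL_apply] at hU hR
  let U : G →* Module.End ℂ E :=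
    { toFun := fun x => ρ.induced ξ₀ s (translateL μ x).toContinuousLinearMap
      map_one' := hext fun f => by rw [hU, translate_one]; rfl
      map_mul' := fun x y => hext fun f => by
        rw [Module.End.mul_apply, hU, hU, hU, translate_translate] }
  let R : A →ₙₐ[ℂ] Module.End ℂ E :=
    { toFun := fun a => ρ.induced ξ₀ s (coeffMulL T μ a)
      map_smul' := fun c a => by simp only [map_smul, MonoidHom.id_apply]
      map_zero' := by simp only [map_zero]
      map_add' := fun a b => by simp only [map_add]
      map_mul' := fun a b => hext fun f => by
        rw [Module.End.mul_apply, hR, hR, hR, coeffMul_coeffMul] }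
  have hU' : ∀ x f ξ, U x (ρ.op f ξ) = ρ.op (translate μ x f) ξ := hU
  have hR' : ∀ a f ξ, R a (ρ.op f ξ) = ρ.op (coeffMul T μ a f) ξ := hR
  refine ⟨U, R, ⟨fun x f => LinearMap.ext (hU' x f), fun a f => LinearMap.ext (hR' a f),
    fun y a => hext fun f => ?_, fun φ hφ f ξ => ?_⟩⟩
  · rw [Module.End.mul_apply, Module.End.mul_apply, hU', hR', hU', hR', coeffMul_translate,
      translate_translate, inv_mul_cancel, translate_one]
  · obtain ⟨c, hc⟩ := hφ ξ₀ hξ₀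
    -- Along the orbit map of `ξ₀`, `φ` becomes a continuous functional on `L¹(G, A)`, which
    -- commutes with the Bochner integral that defines the convolution.
    let Λ : (G →₁[μ] A) →L[ℂ] ℂ := (φ ∘ₗ ρ.orbit ξ₀).mkContinuous |c| fun f =>
      (hc _).trans <| (mul_le_mul_of_nonneg_right (le_abs_self c) (orbitNorm_nonneg _ _)).trans <|
        mul_le_mul_of_nonneg_left (orbitNorm_op_le ξ₀ f) (abs_nonneg c)
    have hΛ : ∀ x, φ (U x (R (f x) ξ)) = Λ (translate μ x (coeffMul T μ (f x) (s ξ))) := fun x => by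
      conv_lhs => rw [← hs ξ, hR', hU']
      rfl
    simp only [hΛ]
    refine ⟨Λ.integrable_comp (integrable_conv T μ f (s ξ)), ?_⟩
    rw [← integral_comp_conv]
    conv_lhs => rw [← hs ξ, ← op_conv_apply]
    rfl

theorem exists_isDiscretisation : ∃ ρd : DiscreteRep T E, ρ.IsDiscretisation ρd := by
  obtain ⟨U, R, hUR⟩ := exists_isCovariantPair hρ
  obtain ⟨ξ₀, hξ₀⟩ := @exists_ne E hρ.1 0
  obtain ⟨s, hs'⟩ := (ρ.orbit ξ₀).exists_rightInverse_of_surjective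
    (LinearMap.range_eq_top.2 (orbit_surjective hρ hξ₀))
  have hs : ∀ v, ρ.op (s v) ξ₀ = v := LinearMap.congr_fun hs'
  have hD := fun h => (descends_discreteOp hρ h).induced_op hs
  refine ⟨⟨ρ.induced ξ₀ s ∘ₗ (discreteOp T μ).toLinearMap, fun h k => LinearMap.ext fun v => ?_⟩,
    U, R, hUR, fun h ξ => ?_⟩
  · simp only [LinearMap.comp_apply, ContinuousLinearMap.coe_coe, Module.End.mul_apply]
    rw [← hs v, hD, hD, hD, discreteOp_discreteConv]
    rfl
  · have h1 := hUR.hasSumInNorm_op_op hρ h (s ξ) ξ₀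
    rw [hs] at h1
    exact h1

end Rep

section Irreducible

variable {G A E : Type*} [Group G] [TopologicalSpace G] [IsTopologicalGroup G]
  [LocallyCompactSpace G] [MeasurableSpace G] [BorelSpace G]
  [NonUnitalNormedRing A] [CompleteSpace A] [StarRing A] [NormedSpace ℂ A]
  [IsScalarTower ℂ A A] [SMulCommClass ℂ A A]
  {T : BoundedAction G A} {μ : Measure G} [μ.IsHaarMeasure] [μ.Regular]
  [AddCommGroup E] [Module ℂ E] {ρ : Rep T μ E}

/-! ### Approximation by discrete measures, and irreducibility -/

/-- Left convolution by `f` is, at each `w`, a limit of left convolutions by discrete measures whose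
norm does not exceed `r`. Otherwise a hyperplane separates `f ⋆ w` from all of these; since point
masses are among them, this gives a bound of the functional on `λ_z (f z · w)`, and integration over
`z` yields a contradiction. -/
theorem conv_mem_closure_discreteOp (f w : G →₁[μ] A) {r : ℝ} (hr : ‖f‖ < r) :
    conv T μ f w ∈ closure ((fun h => discreteOp T μ h w) ''
      Metric.closedBall (0 : lp (fun _ : G => A) 1) r) := by
  classical
  by_contra hy
  have hr0 : 0 < r := (norm_nonneg f).trans_lt hr
  let S : lp (fun _ : G => A) 1 →L[ℂ] (G →₁[μ] A) := (discreteOp T μ).flip w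
  have hconv : Convex ℝ (S '' Metric.closedBall 0 r) :=
    (convex_closedBall _ _).is_linear_image
      ⟨map_add S, map_real_smul S S.continuous⟩
  obtain ⟨φ, u, hφ, hu⟩ := geometric_hahn_banach_closed_point hconv.closure isClosed_closure hy
  have hS : ∀ h : lp (fun _ : G => A) 1, ‖h‖ ≤ r → φ (S h) < u := fun h hh =>
    hφ _ (subset_closure ⟨h, by simpa using hh, rfl⟩)
  have hu0 : 0 < u := by simpa using hS 0 (by simpa using hr0.le)
  have hpt : ∀ z a, φ (translate μ z (coeffMul T μ a w)) ≤ u / r * ‖a‖ := by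
    intro z a
    rcases eq_or_ne a 0 with rfl | ha
    · simp [← pointOp_apply]
    · have ha' : 0 < ‖a‖ := norm_pos_iff.2 ha
      have h1 := hS (((r / ‖a‖ : ℝ) : ℂ) • lp.single 1 z a) (by
        rw [norm_smul, lp.norm_single (by simp), Complex.norm_real,
          Real.norm_of_nonneg (by positivity), div_mul_cancel₀ _ ha'.ne'])
      have h2 : S (lp.single 1 z a) = translate μ z (coeffMul T μ a w) :=
        DFunLike.congr_fun (discreteOp_single T μ z a) w
      rw [map_smul, h2, Complex.coe_smul, map_smul, smul_eq_mul] at h1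
      rw [div_mul_eq_mul_div, le_div_iff₀ hr0]
      rw [div_mul_eq_mul_div, div_lt_iff₀ ha'] at h1
      linarith
  have hint := integrable_conv T μ f w
  have h1 : φ (conv T μ f w) ≤ ∫ z, u / r * ‖f z‖ ∂μ := by
    rw [conv, ← φ.integral_comp_comm hint]
    exact integral_mono (φ.integrable_comp hint) ((L1.integrable_coeFn f).norm.const_mul _)
      fun z => hpt z (f z)
  rw [integral_const_mul, ← L1.norm_eq_integral_norm] at h1
  have h2 : u / r * ‖f‖ ≤ u := by
    rw [div_mul_eq_mul_div, div_le_iff₀ hr0]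
    exact mul_le_mul_of_nonneg_left hr.le hu0.le
  linarith

/-- The discretised representation acts transitively on non-zero vectors. One approximates a
solution and corrects the error, which is as small as desired, by the same procedure; the sum of
the corrections converges geometrically. -/
theorem Rep.IsDiscretisation.exists_op_eq (hρ : IsAlgIrreducible ρ.op) {ρd : DiscreteRep T E}
    (hd : ρ.IsDiscretisation ρd) {ξ : E} (hξ : ξ ≠ 0) (η : E) : ∃ h, ρd.op h ξ = η := by
  obtain ⟨w, hw⟩ := orbit_surjective hρ hξ ξ
  obtain ⟨f₀, rfl⟩ := orbit_surjective hρ hξ η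
  rw [orbit_apply] at hw
  have hdw : ∀ h, ρd.op h ξ = ρ.op (discreteOp T μ h w) ξ := fun h => by
    conv_lhs => rw [← hw, hd.op_op hρ]
  have step : ∀ f : G →₁[μ] A, ∃ p : lp (fun _ : G => A) 1 × (G →₁[μ] A),
      ‖p.1‖ ≤ 2 * ‖f‖ ∧ ‖p.2‖ ≤ ‖f‖ / 2 ∧
        ρ.op f ξ = ρ.op (discreteOp T μ p.1 w) ξ + ρ.op p.2 ξ := by
    intro f
    rcases eq_or_ne f 0 with rfl | hf
    · exact ⟨0, by simp⟩
    have hf' : 0 < ‖f‖ := norm_pos_iff.2 hf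
    obtain ⟨_, ⟨h, hh, rfl⟩, hlt⟩ := Metric.mem_closure_iff.1
      (conv_mem_closure_discreteOp (T := T) f w (r := 2 * ‖f‖) (by linarith)) (‖f‖ / 2)
      (half_pos hf')
    refine ⟨(h, conv T μ f w - discreteOp T μ h w), by simpa using hh, ?_, ?_⟩
    · rw [← dist_eq_norm]
      exact hlt.le
    · rw [map_sub, LinearMap.sub_apply, op_conv_apply, hw]
      abel
  choose p hp1 hp2 hp using step
  -- `F n` represents the error that is left after `n` corrections.
  let F : ℕ → G →₁[μ] A := fun n => (fun f => (p f).2)^[n] f₀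
  have hF : ∀ n, F (n + 1) = (p (F n)).2 := fun n => Function.iterate_succ_apply' _ _ _
  have hFn : ∀ n, ‖F n‖ ≤ ‖f₀‖ * (1 / 2) ^ n := by
    intro n
    induction n with
    | zero => simp [F]
    | succ n ih =>
      rw [hF, pow_succ]
      linarith [hp2 (F n)]
  have hs : Summable fun n => (p (F n)).1 := by
    refine Summable.of_norm_bounded (g := fun n => 2 * (‖f₀‖ * (1 / 2) ^ n))
      ((summable_geometric_two.mul_left _).mul_left _) fun n => ?_
    linarith [hp1 (F n), hFn n]
  refine ⟨∑' n, (p (F n)).1, ?_⟩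
  rw [hdw, orbit_apply]
  let S : lp (fun _ : G => A) 1 →L[ℂ] (G →₁[μ] A) := (discreteOp T μ).flip w
  have hsum : ∀ n, ρ.op f₀ ξ = ρ.op (∑ k ∈ Finset.range n, S (p (F k)).1) ξ + ρ.op (F n) ξ := by
    intro n
    induction n with
    | zero => simp [F]
    | succ n ih =>
      rw [ih, hp (F n), Finset.sum_range_succ, map_add, LinearMap.add_apply, hF, ← add_assoc]
      rfl
  have hF0 : Tendsto F atTop (𝓝 0) := by
    refine squeeze_zero_norm hFn ?_
    simpa using (tendsto_pow_atTop_nhds_zero_of_lt_one (by norm_num : (0 : ℝ) ≤ 1 / 2)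
      (by norm_num)).const_mul ‖f₀‖
  have hlim : Tendsto (fun n => ∑ k ∈ Finset.range n, S (p (F k)).1 + F n - f₀) atTop
      (𝓝 (S (∑' n, (p (F n)).1) + 0 - f₀)) :=
    ((hs.hasSum.mapL S).tendsto_sum_nat.add hF0).sub_const f₀
  have hmem : S (∑' n, (p (F n)).1) + 0 - f₀ ∈ LinearMap.ker (ρ.orbit ξ) := by
    refine (isClosed_ker_orbit hρ ξ).mem_of_tendsto hlim (.of_forall fun n => ?_)
    rw [SetLike.mem_coe, LinearMap.mem_ker, map_sub, map_add, sub_eq_zero]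
    exact (hsum n).symm
  rw [LinearMap.mem_ker, map_sub, add_zero, sub_eq_zero] at hmem
  exact hmem

theorem Rep.IsDiscretisation.isAlgIrreducible (hρ : IsAlgIrreducible ρ.op) {ρd : DiscreteRep T E}
    (hd : ρ.IsDiscretisation ρd) : IsAlgIrreducible ρd.op := by
  refine ⟨hρ.1, fun h0 => ?_, fun F hF => ?_⟩
  · obtain ⟨ξ, hξ⟩ := @exists_ne E hρ.1 0
    obtain ⟨h, hh⟩ := hd.exists_op_eq hρ hξ ξ
    exact hξ (by rw [← hh, h0]; rfl)
  · refine or_iff_not_imp_left.2 fun hne => eq_top_iff.2 fun η _ => ?_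
    obtain ⟨ξ, hξF, hξ⟩ := F.ne_bot_iff.1 hne
    obtain ⟨h, rfl⟩ := hd.exists_op_eq hρ hξ η
    exact hF h ξ hξF

end Irreducible

end TwistedL1

end

theorem mainTheorem8 {G A E : Type*}
    [Group G] [TopologicalSpace G] [IsTopologicalGroup G] [LocallyCompactSpace G] [T2Space G]
    [MeasurableSpace G] [BorelSpace G]
    (μ : Measure G) [μ.IsHaarMeasure] [μ.Regular]
    [NonUnitalNormedRing A] [CompleteSpace A] [StarRing A] [NormedStarGroup A]
    [NormedSpace ℂ A] [IsScalarTower ℂ A A] [SMulCommClass ℂ A A] [StarModule ℂ A]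
    (hA : ∃ l : Filter A, l.NeBot ∧ ∀ a : A, Tendsto (fun e => e * a) l (𝓝 a))
    (T : TwistedL1.BoundedAction G A)
    [AddCommGroup E] [Module ℂ E]
    (ρ : TwistedL1.Rep T μ E) (hρ : TwistedL1.IsAlgIrreducible ρ.op) :
    (∃! ρd : TwistedL1.DiscreteRep T E, ρ.IsDiscretisation ρd) ∧
      ∀ ρd : TwistedL1.DiscreteRep T E, ρ.IsDiscretisation ρd →
        TwistedL1.IsAlgIrreducible ρd.op := by
  obtain ⟨ρd, hd⟩ := TwistedL1.Rep.exists_isDiscretisation hρ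
  exact ⟨⟨ρd, hd, fun ρd' hd' => hd'.unique hρ hd⟩, fun ρd' hd' => hd'.isAlgIrreducible hρ⟩
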